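/- For a finite family of points $v_1,\dots,v_N\in\mathbb R^2$ put $$P(v_1,\dots,v_N)=\int_{\mathbb R^2}\max_i e^{-|x-v_i|^2}\,dx .$$ For a measurable density $f:\mathbb R^2\to[0,\infty]$ put $$P_f(v_1,\dots,v_N)=\int_{\mathbb R^2}\max_i f(x-v_i)\,dx,\qquad P^{\mathrm{Vor}}_f(v_1,\dots,v_N)=\sum_{p\in\{v_1,\dots,v_N\}}\int_{V_p} f(x-p)\,dx ,$$ where the sum is over the distinct points $p$ of the configuration and $V_p=\{x:|x-p|\le|x-v_i|\text{ for all }i\}$ is the Voronoi region of $p$. We write $P(\pm v_1,\pm v_2)=P(v_1,-v_1,v_2,-v_2)$, and similarly for $P_f$ and $P^{\mathrm{Vor}}_f$. **Theorem.** Let $v_1,v_2\in\mathbb R^2$ be orthogonal and of equal length, and let $E=|v_1|^2+|v_2|^2$. 1. Among all pairs $w_1,w_2\in\mathbb R^2$ with $|w_1|^2+|w_2|^2=E$, the value $P(\pm w_1,\pm w_2)$ is maximal at $(w_1,w_2)=(v_1,v_2)$. 2. The same holds for $P_f$ and for $P^{\mathrm{Vor}}_f$ whenever $f$ is a radially symmetric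 density that is nonincreasing in $|x|$. 3. For an arbitrary radially symmetric density $f$ (not necessarily monotone), $P^{\mathrm{Vor}}_f(\pm w_1,\pm w_2)$ is maximal at $(w_1,w_2)=(v_1,v_2)$ among all orthogonal pairs $w_1,w_2\in\mathbb R^2$ with $|w_1|^2+|w_2|^2=E$. -/

import Mathlib

open MeasureTheory
open scoped ENNReal

/-- `P(v₁, …, v_N) = ∫_{ℝⁿ} max_i exp(-|x - v_i|²) dx`. -/
noncomputable def gaussianP {n N : ℕ} (v : Fin N → EuclideanSpace ℝ (Fin n)) : ℝ :=
  ∫ x, ⨆ i, Real.exp (-‖x - v i‖ ^ 2)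

/-- The same functional with a density `f` in place of `exp(-|x|²)`:
`∫_{ℝⁿ} max_i f(x - v_i) dx`. -/
noncomputable def densityP {n N : ℕ} (f : EuclideanSpace ℝ (Fin n) → ℝ≥0∞)
    (v : Fin N → EuclideanSpace ℝ (Fin n)) : ℝ≥0∞ :=
  ∫⁻ x, ⨆ i, f (x - v i)

/-- The (closed) Voronoi region of the point `p` with respect to the points `v i`. -/
def voronoiRegion {n N : ℕ} (v : Fin N → EuclideanSpace ℝ (Fin n))
    (p : EuclideanSpace ℝ (Fin n)) : Set (EuclideanSpace ℝ (Fin n)) :=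
  {x | ∀ i, dist x p ≤ dist x (v i)}

/-- Nearest-point decoding of a noise with density `f`: the sum, over the distinct points `p` of
the configuration, of the measure with density `f` centered at `p` of the Voronoi region of `p`.
Coinciding points have one common Voronoi region, which is counted once. -/
noncomputable def voronoiP {n N : ℕ} (f : EuclideanSpace ℝ (Fin n) → ℝ≥0∞)
    (v : Fin N → EuclideanSpace ℝ (Fin n)) : ℝ≥0∞ :=
  ∑ p ∈ (Set.finite_range v).toFinset, ∫⁻ x in voronoiRegion v p, f (x - p)

/-- The antipodal configuration `±v₁, ±v₂`. -/
def antipodal {n : ℕ} (w : EuclideanSpace ℝ (Fin n) × EuclideanSpace ℝ (Fin n)) :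
    Fin 4 → EuclideanSpace ℝ (Fin n) :=
  ![w.1, -w.1, w.2, -w.2]

/-- `f(x)` depends only on `|x|`. -/
def IsRadial {n : ℕ} (f : EuclideanSpace ℝ (Fin n) → ℝ≥0∞) : Prop :=
  ∀ x y, ‖x‖ = ‖y‖ → f x = f y

/-- `f(x)` is a nonincreasing function of `|x|` (in particular it is radial). -/
def IsRadiallyNonincreasing {n : ℕ} (f : EuclideanSpace ℝ (Fin n) → ℝ≥0∞) : Prop :=
  ∀ x y, ‖x‖ ≤ ‖y‖ → f y ≤ f x

/-!
Each of the functionals is the integral of a function `F` of the distance `d(x)` from `x` to the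
configuration `±u, ±v`.

If `F` is nonincreasing, it suffices to compare the areas of the sets `d ≤ c`, which are unions of
the pairs of balls around `±u` and around `±v`. When `u ⟂ v`, on each circle centered at the origin
the arcs cut out by the two pairs are either disjoint or cover the circle, by Parseval's identity,
so rotating `v` at fixed length to a direction orthogonal to `u` maximizes the area.

If `u ⟂ v`, the points `±u, ±v` are the vertices of a rhombus of side `L`, where
`L ^ 2 = |u| ^ 2 + |v| ^ 2`, and by symmetry the integral is four times the one over a quadrant.
Move the two Voronoi cells of that quadrant so that their centers `u` and `v` go to the origin and
their boundary rays along the axes come to lie on one line, with the cells on opposite sides of it.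
The two pieces are then disjoint and contained in a region depending only on `L`, which they fill
when `|u| = |v|`; the integrand has become `F(|z|)`, for which monotonicity is irrelevant.
-/

section Integrals

open Set

variable {α : Type*} [MeasurableSpace α] {μ ν : Measure α}

theorem volume_setOf_pos_and_ofReal_lt (c : ℝ≥0∞) :
    volume {t : ℝ | 0 < t ∧ ENNReal.ofReal t < c} = c := by
  by_cases hc : c = ∞
  · have hset : {t : ℝ | 0 < t ∧ ENNReal.ofReal t < c} = Ioi 0 := by ext t; simp [hc]
    rw [hset, Real.volume_Ioi, hc]
  · have hset : {t : ℝ | 0 < t ∧ ENNReal.ofReal t < c} = Ioo 0 c.toReal := by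
      ext t
      exact and_congr_right fun ht => ENNReal.ofReal_lt_iff_lt_toReal ht.le hc
    rw [hset, Real.volume_Ioo, sub_zero, ENNReal.ofReal_toReal hc]

theorem lintegral_eq_lintegral_measure_ofReal_lt (μ : Measure α) [SFinite μ] {g : α → ℝ≥0∞}
    (hg : Measurable g) :
    ∫⁻ x, g x ∂μ = ∫⁻ t, μ {x | 0 < t ∧ ENNReal.ofReal t < g x} := by
  have hmeas : MeasurableSet {p : α × ℝ | 0 < p.2 ∧ ENNReal.ofReal p.2 < g p.1} :=
    (measurableSet_lt measurable_const measurable_snd).inter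
      (measurableSet_lt (ENNReal.measurable_ofReal.comp measurable_snd) (hg.comp measurable_fst))
  calc ∫⁻ x, g x ∂μ = ∫⁻ x, volume {t : ℝ | 0 < t ∧ ENNReal.ofReal t < g x} ∂μ := by
        simp only [volume_setOf_pos_and_ofReal_lt]
    _ = (μ.prod volume) {p : α × ℝ | 0 < p.2 ∧ ENNReal.ofReal p.2 < g p.1} :=
        (Measure.prod_apply hmeas).symm
    _ = ∫⁻ t, μ {x | 0 < t ∧ ENNReal.ofReal t < g x} := Measure.prod_apply_symm hmeas

theorem measure_le_measure_of_isLowerSet [LinearOrder α] [TopologicalSpace α] [OrderTopology α]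
    [SecondCountableTopology α] {I : Set α} (hI : IsLowerSet I)
    (h : ∀ c, μ (Iic c) ≤ ν (Iic c)) : μ I ≤ ν I := by
  rcases I.eq_empty_or_nonempty with rfl | hne
  · simp
  have := hI.ordConnected
  have := hne.to_subtype
  obtain ⟨u, hu, hlim⟩ := Filter.exists_seq_monotone_tendsto_atTop_atTop I
  have hunion : I = ⋃ n, Iic (u n : α) := by
    refine Subset.antisymm (fun r hr => ?_) (iUnion_subset fun n r hr => hI hr (u n).2)
    obtain ⟨n, hn⟩ := (hlim.eventually_ge_atTop ⟨r, hr⟩).exists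
    exact mem_iUnion.2 ⟨n, hn⟩
  have hmono : Monotone fun n => Iic (u n : α) := fun m n hmn => Iic_subset_Iic.2 (hu hmn)
  rw [hunion, hmono.measure_iUnion, hmono.measure_iUnion]
  exact iSup_mono fun n => h (u n)

theorem lintegral_le_lintegral_of_antitone [LinearOrder α] [TopologicalSpace α] [OrderTopology α]
    [SecondCountableTopology α] [BorelSpace α] [SFinite μ] [SFinite ν] {F : α → ℝ≥0∞}
    (hF : Antitone F) (h : ∀ c, μ (Iic c) ≤ ν (Iic c)) : ∫⁻ r, F r ∂μ ≤ ∫⁻ r, F r ∂ν := by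
  rw [lintegral_eq_lintegral_measure_ofReal_lt μ hF.measurable,
    lintegral_eq_lintegral_measure_ofReal_lt ν hF.measurable]
  refine lintegral_mono fun t => measure_le_measure_of_isLowerSet (fun r s hsr hr => ?_) h
  exact ⟨hr.1, hr.2.trans_le (hF hsr)⟩

theorem lintegral_eq_two_mul_setLIntegral {T : α → α} (hT : MeasurePreserving T μ μ)
    (hTe : MeasurableEmbedding T) {D : Set α} (hD : MeasurableSet D) (hTD : T ⁻¹' D =ᵐ[μ] Dᶜ)
    {g : α → ℝ≥0∞} (hg : ∀ x, g (T x) = g x) : ∫⁻ x, g x ∂μ = 2 * ∫⁻ x in D, g x ∂μ := by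
  have hcompl : ∫⁻ x in Dᶜ, g x ∂μ = ∫⁻ x in D, g x ∂μ := by
    calc ∫⁻ x in Dᶜ, g x ∂μ = ∫⁻ x in T ⁻¹' D, g (T x) ∂μ := by
          simp only [hg]
          exact (setLIntegral_congr hTD).symm
      _ = ∫⁻ x in D, g x ∂μ := hT.setLIntegral_comp_preimage_emb hTe g D
  rw [← lintegral_add_compl g hD, hcompl, two_mul]

theorem measure_union_preimage_le {T : α → α} (hT : MeasurePreserving T μ μ) {K K' S : Set α}
    (hK' : MeasurableSet K') (hS : MeasurableSet S) (hTS : T ⁻¹' S = S) (hinter : K ∩ K' ⊆ S)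
    (hcover : S ⊆ K ∪ K') : μ (K ∪ T ⁻¹' K') ≤ μ (K ∪ K') := by
  have hdisj : Disjoint (K \ S) (K' \ S) :=
    disjoint_left.2 fun x hx hx' => hx.2 (hinter ⟨hx.1, hx'.1⟩)
  have hpre : μ (T ⁻¹' K' \ S) = μ (K' \ S) := by
    rw [← hT.measure_preimage (hK'.diff hS).nullMeasurableSet, preimage_sdiff, hTS]
  calc μ (K ∪ T ⁻¹' K')
      = μ ((K ∪ T ⁻¹' K') ∩ S) + μ (K \ S ∪ T ⁻¹' K' \ S) := by
        rw [← union_sdiff_distrib, measure_inter_add_sdiff _ hS]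
    _ ≤ μ S + (μ (K \ S) + μ (T ⁻¹' K' \ S)) :=
        add_le_add (measure_mono inter_subset_right) (measure_union_le _ _)
    _ = μ ((K ∪ K') ∩ S) + μ (K \ S ∪ K' \ S) := by
        rw [hpre, measure_union hdisj (hK'.diff hS), inter_eq_right.2 hcover]
    _ = μ (K ∪ K') := by rw [← union_sdiff_distrib, measure_inter_add_sdiff _ hS]

end Integrals

section NearestPoint

open Metric Set

theorem infDist_le_iff_of_isCompact {α : Type*} [PseudoMetricSpace α] {s : Set α} (hs : IsCompact s)
    (hne : s.Nonempty) {x : α} {c : ℝ} : infDist x s ≤ c ↔ ∃ y ∈ s, dist x y ≤ c := by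
  refine ⟨fun h => ?_, fun ⟨y, hy, h⟩ => (infDist_le_dist_of_mem hy).trans h⟩
  obtain ⟨y, hy, hxy⟩ := hs.exists_infDist_eq_dist hne x
  exact ⟨y, hy, hxy ▸ h⟩

theorem measure_setOf_dist_eq_dist {E : Type*} [NormedAddCommGroup E] [InnerProductSpace ℝ E]
    [FiniteDimensional ℝ E] [MeasurableSpace E] [BorelSpace E] (μ : Measure E)
    [μ.IsAddHaarMeasure] {p q : E} (h : p ≠ q) : μ {x | dist x p = dist x q} = 0 := by
  have hset : {x | dist x p = dist x q} = AffineSubspace.perpBisector p q := by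
    ext x; exact AffineSubspace.mem_perpBisector_iff_dist_eq.symm
  rw [hset]
  exact Measure.addHaar_affineSubspace μ _ (AffineSubspace.perpBisector_eq_top.not.2 h)

variable {n N : ℕ}

theorem IsRadial.exists_eq_comp_norm {f : EuclideanSpace ℝ (Fin n) → ℝ≥0∞} (hf : IsRadial f) :
    ∃ F : ℝ → ℝ≥0∞, f = fun x => F ‖x‖ :=
  (Function.factorsThrough_iff f).1 fun x y => hf x y

theorem IsRadiallyNonincreasing.exists_antitone_eq_comp_norm
    {f : EuclideanSpace ℝ (Fin n) → ℝ≥0∞} (hf : IsRadiallyNonincreasing f) :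
    ∃ F : ℝ → ℝ≥0∞, Antitone F ∧ f = fun x => F ‖x‖ := by
  refine ⟨fun r => ⨆ y : {y : EuclideanSpace ℝ (Fin n) // r ≤ ‖y‖}, f y, fun r s hrs =>
    iSup_le fun y => le_iSup_of_le ⟨y, hrs.trans y.2⟩ le_rfl, funext fun x => ?_⟩
  exact le_antisymm (le_iSup_of_le ⟨x, le_rfl⟩ le_rfl) (iSup_le fun y => hf x y y.2)

theorem densityP_comp_norm [NeZero N] {F : ℝ → ℝ≥0∞} (hF : Antitone F)
    (v : Fin N → EuclideanSpace ℝ (Fin n)) :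
    densityP (fun x => F ‖x‖) v = ∫⁻ x, F (infDist x (range v)) := by
  refine lintegral_congr fun x => le_antisymm (iSup_le fun i => ?_) ?_
  · change F ‖x - v i‖ ≤ _
    rw [← dist_eq_norm]
    exact hF (infDist_le_dist_of_mem (mem_range_self i))
  · obtain ⟨-, ⟨i, rfl⟩, hi⟩ :=
      (finite_range v).isCompact.exists_infDist_eq_dist (range_nonempty v) x
    rw [hi, dist_eq_norm]
    exact le_iSup (fun i => F ‖x - v i‖) i

theorem mem_voronoiRegion_iff_dist_eq_infDist {v : Fin N → EuclideanSpace ℝ (Fin n)}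
    {p x : EuclideanSpace ℝ (Fin n)} (hp : p ∈ range v) :
    x ∈ voronoiRegion v p ↔ dist x p = infDist x (range v) := by
  rw [(infDist_le_dist_of_mem hp).ge_iff_eq'.symm, le_infDist ⟨p, hp⟩, forall_mem_range]
  rfl

theorem measurableSet_voronoiRegion (v : Fin N → EuclideanSpace ℝ (Fin n))
    (p : EuclideanSpace ℝ (Fin n)) : MeasurableSet (voronoiRegion v p) := by
  simp only [voronoiRegion, ofPred_forall]
  exact MeasurableSet.iInter fun i => measurableSet_le (by fun_prop) (by fun_prop)

theorem aedisjoint_voronoiRegion {v : Fin N → EuclideanSpace ℝ (Fin n)}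
    {p q : EuclideanSpace ℝ (Fin n)} (hp : p ∈ range v) (hq : q ∈ range v) (hpq : p ≠ q) :
    AEDisjoint volume (voronoiRegion v p) (voronoiRegion v q) := by
  refine measure_mono_null (fun x hx => ?_) (measure_setOf_dist_eq_dist volume hpq)
  rw [mem_inter_iff, mem_voronoiRegion_iff_dist_eq_infDist hp,
    mem_voronoiRegion_iff_dist_eq_infDist hq] at hx
  exact hx.1.trans hx.2.symm

theorem iUnion_voronoiRegion [NeZero N] (v : Fin N → EuclideanSpace ℝ (Fin n)) :
    ⋃ p ∈ (finite_range v).toFinset, voronoiRegion v p = univ := by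
  refine eq_univ_of_forall fun x => ?_
  obtain ⟨p, hp, hxp⟩ := (finite_range v).isCompact.exists_infDist_eq_dist (range_nonempty v) x
  exact mem_biUnion ((finite_range v).mem_toFinset.2 hp)
    ((mem_voronoiRegion_iff_dist_eq_infDist hp).2 hxp.symm)

theorem voronoiP_comp_norm [NeZero N] (F : ℝ → ℝ≥0∞) (v : Fin N → EuclideanSpace ℝ (Fin n)) :
    voronoiP (fun x => F ‖x‖) v = ∫⁻ x, F (infDist x (range v)) := by
  calc voronoiP (fun x => F ‖x‖) v
      = ∑ p ∈ (finite_range v).toFinset, ∫⁻ x in voronoiRegion v p, F (infDist x (range v)) := by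
        refine Finset.sum_congr rfl fun p hp =>
          setLIntegral_congr_fun (measurableSet_voronoiRegion v p) fun x hx => ?_
        rw [(finite_range v).mem_toFinset] at hp
        simp only [← (mem_voronoiRegion_iff_dist_eq_infDist hp).1 hx, dist_eq_norm]
    _ = ∫⁻ x in ⋃ p ∈ (finite_range v).toFinset, voronoiRegion v p, F (infDist x (range v)) := by
        refine (lintegral_biUnion_finset₀ (fun p hp q hq hpq => ?_)
          (fun p _ => (measurableSet_voronoiRegion v p).nullMeasurableSet) _).symm
        rw [Finset.mem_coe, (finite_range v).mem_toFinset] at hp hq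
        exact aedisjoint_voronoiRegion hp hq hpq
    _ = ∫⁻ x, F (infDist x (range v)) := by rw [iUnion_voronoiRegion, setLIntegral_univ]

end NearestPoint

section Gaussian

variable {n N : ℕ}

theorem gaussianP_eq_toReal_densityP [NeZero N] (v : Fin N → EuclideanSpace ℝ (Fin n)) :
    gaussianP v = (densityP (fun x => ENNReal.ofReal (Real.exp (-‖x‖ ^ 2))) v).toReal := by
  rw [gaussianP, densityP, integral_eq_lintegral_of_nonneg_ae]
  · congr 1
    refine lintegral_congr fun x => ENNReal.ofReal_mono.map_ciSup_of_continuousAt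
      ENNReal.continuous_ofReal.continuousAt (Set.finite_range _).bddAbove
  · exact .of_forall fun x => Real.iSup_nonneg fun i => (Real.exp_pos _).le
  · exact (Measurable.iSup fun i => Continuous.measurable (by fun_prop)).aestronglyMeasurable

theorem densityP_ne_top {f : EuclideanSpace ℝ (Fin n) → ℝ≥0∞} (hf : Measurable f)
    (hfin : ∫⁻ x, f x ≠ ∞) (v : Fin N → EuclideanSpace ℝ (Fin n)) : densityP f v ≠ ∞ := by
  refine ne_top_of_le_ne_top (b := ∑ _i : Fin N, ∫⁻ x, f x)
    (ENNReal.sum_ne_top.2 fun _ _ => hfin) ?_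
  calc densityP f v ≤ ∫⁻ x, ∑ i, f (x - v i) := lintegral_mono fun x => iSup_le fun i =>
        Finset.single_le_sum (f := fun i => f (x - v i)) (fun _ _ => zero_le) (Finset.mem_univ i)
    _ = ∑ _i : Fin N, ∫⁻ x, f x := by
        rw [lintegral_finsetSum _ fun i _ => hf.fun_comp (measurable_id'.sub_const (v i))]
        simp only [lintegral_sub_right_eq_self]

theorem integrable_rexp_neg_sq_norm {V : Type*} [NormedAddCommGroup V] [InnerProductSpace ℝ V]
    [FiniteDimensional ℝ V] [MeasurableSpace V] [BorelSpace V] :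
    Integrable fun x : V => Real.exp (-‖x‖ ^ 2) := by
  refine .of_integral_ne_zero ?_
  have h := GaussianFourier.integral_rexp_neg_mul_sq_norm (V := V) one_pos
  simp only [neg_mul, one_mul] at h
  rw [h]
  positivity

theorem isRadiallyNonincreasing_rexp_neg_sq_norm :
    IsRadiallyNonincreasing fun x : EuclideanSpace ℝ (Fin n) =>
      ENNReal.ofReal (Real.exp (-‖x‖ ^ 2)) := fun x _ hxy =>
  ENNReal.ofReal_le_ofReal
    (Real.exp_le_exp.2 (neg_le_neg (pow_le_pow_left₀ (norm_nonneg x) hxy 2)))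

theorem gaussianP_le_gaussianP [NeZero N] {v w : Fin N → EuclideanSpace ℝ (Fin n)}
    (h : densityP (fun x => ENNReal.ofReal (Real.exp (-‖x‖ ^ 2))) v ≤
      densityP (fun x => ENNReal.ofReal (Real.exp (-‖x‖ ^ 2))) w) :
    gaussianP v ≤ gaussianP w := by
  rw [gaussianP_eq_toReal_densityP, gaussianP_eq_toReal_densityP]
  exact ENNReal.toReal_mono (densityP_ne_top (by fun_prop)
    integrable_rexp_neg_sq_norm.lintegral_lt_top.ne w) h

end Gaussian

section Antipodal

open Metric Set

theorem range_antipodal {n : ℕ} (w : EuclideanSpace ℝ (Fin n) × EuclideanSpace ℝ (Fin n)) :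
    range (antipodal w) = {w.1, -w.1, w.2, -w.2} := by
  simp only [antipodal, Matrix.range_cons, Matrix.range_empty, union_empty, singleton_union]

theorem infDist_antipodal_map {n : ℕ}
    (T : EuclideanSpace ℝ (Fin n) ≃ₗᵢ[ℝ] EuclideanSpace ℝ (Fin n))
    (u v x : EuclideanSpace ℝ (Fin n)) :
    infDist (T x) (range (antipodal (T u, T v))) = infDist x (range (antipodal (u, v))) := by
  have himage : range (antipodal (T u, T v)) = T '' range (antipodal (u, v)) := by
    simp only [range_antipodal, image_insert_eq, image_singleton, map_neg]
  rw [himage, infDist_image T.isometry]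

theorem lintegral_infDist_antipodal_map {n : ℕ}
    (T : EuclideanSpace ℝ (Fin n) ≃ₗᵢ[ℝ] EuclideanSpace ℝ (Fin n)) (F : ℝ → ℝ≥0∞)
    (u v : EuclideanSpace ℝ (Fin n)) :
    ∫⁻ x, F (infDist x (range (antipodal (T u, T v)))) =
      ∫⁻ x, F (infDist x (range (antipodal (u, v)))) := by
  rw [← T.measurePreserving.lintegral_comp_emb T.toHomeomorph.measurableEmbedding]
  simp only [infDist_antipodal_map]

/-- The union of the closed balls of radius `c` centered at `u` and `-u`. The points at distance
at most `c` from the configuration `±u, ±v` form the union of two such sets. -/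
def twinBall {V : Type*} [NormedAddCommGroup V] (u : V) (c : ℝ) : Set V :=
  closedBall u c ∪ closedBall (-u) c

theorem infDist_antipodal_le_iff {n : ℕ} {u v x : EuclideanSpace ℝ (Fin n)} {c : ℝ} :
    infDist x (range (antipodal (u, v))) ≤ c ↔ x ∈ twinBall u c ∪ twinBall v c := by
  rw [infDist_le_iff_of_isCompact (finite_range _).isCompact (range_nonempty _)]
  simp only [range_antipodal, mem_insert_iff, mem_singleton_iff, exists_eq_or_imp, exists_eq_left,
    twinBall, mem_union, mem_closedBall, or_assoc]

theorem isCompact_twinBall {V : Type*} [NormedAddCommGroup V] [ProperSpace V] (u : V) (c : ℝ) :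
    IsCompact (twinBall u c) :=
  (isCompact_closedBall _ _).union (isCompact_closedBall _ _)

theorem preimage_twinBall {V : Type*} [NormedAddCommGroup V] [NormedSpace ℝ V] (T : V ≃ₗᵢ[ℝ] V)
    (u : V) (c : ℝ) : T ⁻¹' twinBall (T u) c = twinBall u c := by
  simp only [twinBall, preimage_union, ← map_neg, T.isometry.preimage_closedBall]

theorem radius_nonneg_of_mem_twinBall {V : Type*} [NormedAddCommGroup V] {u x : V} {c : ℝ}
    (h : x ∈ twinBall u c) : 0 ≤ c :=
  h.elim (fun h => dist_nonneg.trans (mem_closedBall.1 h))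
    fun h => dist_nonneg.trans (mem_closedBall.1 h)

theorem mem_twinBall_iff {V : Type*} [NormedAddCommGroup V] [InnerProductSpace ℝ V] {u x : V}
    {c : ℝ} (hc : 0 ≤ c) : x ∈ twinBall u c ↔ ‖x‖ ^ 2 + ‖u‖ ^ 2 - c ^ 2 ≤ 2 * |inner ℝ x u| := by
  rw [twinBall, mem_union, mem_closedBall, mem_closedBall, dist_eq_norm, dist_eq_norm,
    ← sq_le_sq₀ (norm_nonneg _) hc, ← sq_le_sq₀ (norm_nonneg _) hc, sub_neg_eq_add,
    norm_sub_sq_real, norm_add_sq_real, ← abs_two, ← abs_mul, abs_two, le_abs]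
  constructor <;> rintro (h | h) <;> [left; right; left; right] <;> linarith

end Antipodal

/-- The Euclidean plane `ℝ²`. -/
abbrev Plane : Type := EuclideanSpace ℝ (Fin 2)

section OrthogonalPosition

open Metric Set

theorem Plane.norm_sq (x : Plane) : ‖x‖ ^ 2 = x 0 ^ 2 + x 1 ^ 2 := by
  rw [EuclideanSpace.real_norm_sq_eq, Fin.sum_univ_two]

theorem Plane.inner_eq (x y : Plane) : inner ℝ x y = x 0 * y 0 + x 1 * y 1 := by
  simp only [PiLp.inner_apply, Fin.sum_univ_two, RCLike.inner_apply, conj_trivial, mul_comm]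

theorem Plane.inner_sq_add_inner_sq {u v : Plane} (h : inner ℝ u v = 0) (x : Plane) :
    ‖v‖ ^ 2 * inner ℝ x u ^ 2 + ‖u‖ ^ 2 * inner ℝ x v ^ 2 = ‖u‖ ^ 2 * ‖v‖ ^ 2 * ‖x‖ ^ 2 := by
  simp only [Plane.norm_sq, Plane.inner_eq] at h ⊢
  linear_combination ((x 0 ^ 2 - x 1 ^ 2) * (u 0 * v 0 - u 1 * v 1) +
    2 * x 0 * x 1 * (u 0 * v 1 + u 1 * v 0)) * h

theorem mem_twinBall_union_of_norm_eq {u v x y : Plane} {c : ℝ} (h : inner ℝ u v = 0)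
    (hxu : x ∈ twinBall u c) (hxv : x ∈ twinBall v c) (hxy : ‖y‖ = ‖x‖) :
    y ∈ twinBall u c ∪ twinBall v c := by
  have hc := radius_nonneg_of_mem_twinBall hxu
  by_contra! hy
  simp only [mem_union, not_or, mem_twinBall_iff hc, hxy, not_le] at hy
  rw [mem_twinBall_iff hc] at hxu hxv
  have hu : |inner ℝ y u| < |inner ℝ x u| := by linarith
  have hv : |inner ℝ y v| < |inner ℝ x v| := by linarith
  -- Parseval's identity forbids `y` to have smaller components than `x` along both `u` and `v`.
  have hu0 : u ≠ 0 := by rintro rfl; simp at hu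
  have hxyeq := Plane.inner_sq_add_inner_sq h x
  rw [← hxy, ← Plane.inner_sq_add_inner_sq h y] at hxyeq
  have hlt := add_lt_add_of_le_of_lt
    (mul_le_mul_of_nonneg_left (sq_lt_sq.2 hu).le (sq_nonneg ‖v‖))
    (mul_lt_mul_of_pos_left (sq_lt_sq.2 hv) (by positivity : 0 < ‖u‖ ^ 2))
  exact hlt.ne' hxyeq

theorem volume_twinBall_union_le {u v : Plane} (T : Plane ≃ₗᵢ[ℝ] Plane)
    (h : inner ℝ u (T v) = 0) (c : ℝ) :
    volume (twinBall u c ∪ twinBall v c) ≤ volume (twinBall u c ∪ twinBall (T v) c) := by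
  let R : Set ℝ := norm '' (twinBall u c ∩ twinBall (T v) c)
  have hR : MeasurableSet R :=
    (((isCompact_twinBall u c).inter (isCompact_twinBall (T v) c)).image
      continuous_norm).measurableSet
  rw [← preimage_twinBall T v]
  refine measure_union_preimage_le (S := norm ⁻¹' R) T.measurePreserving
    (isCompact_twinBall _ _).measurableSet (measurable_norm hR) ?_ (subset_preimage_image _ _) ?_
  · simp only [← preimage_comp, Function.comp_def, T.norm_map]
  · rintro y ⟨x, ⟨hxu, hxv⟩, hxy⟩
    exact mem_twinBall_union_of_norm_eq h hxu hxv hxy.symm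

theorem lintegral_infDist_antipodal_le_map {F : ℝ → ℝ≥0∞} (hF : Antitone F) {u v : Plane}
    (T : Plane ≃ₗᵢ[ℝ] Plane) (h : inner ℝ u (T v) = 0) :
    ∫⁻ x, F (infDist x (range (antipodal (u, v)))) ≤
      ∫⁻ x, F (infDist x (range (antipodal (u, T v)))) := by
  rw [← lintegral_map hF.measurable measurable_infDist,
    ← lintegral_map hF.measurable measurable_infDist]
  refine lintegral_le_lintegral_of_antitone hF fun c => ?_
  rw [Measure.map_apply measurable_infDist measurableSet_Iic,
    Measure.map_apply measurable_infDist measurableSet_Iic]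
  simp only [preimage, mem_Iic, infDist_antipodal_le_iff, Set.ofPred_mem_eq]
  exact volume_twinBall_union_le T h c

theorem exists_isometry_apply_eq {V : Type*} [NormedAddCommGroup V] [InnerProductSpace ℝ V]
    {x y : V} (h : ‖x‖ = ‖y‖) : ∃ T : V ≃ₗᵢ[ℝ] V, T x = y :=
  ⟨_, Submodule.reflection_sub h⟩

theorem Plane.exists_isometry_inner_eq_zero (u v : Plane) :
    ∃ T : Plane ≃ₗᵢ[ℝ] Plane, inner ℝ u (T v) = 0 := by
  obtain ⟨T, hT⟩ := exists_isometry_apply_eq (x := u) (y := !₂[‖u‖, 0])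
    (by simp [EuclideanSpace.norm_eq])
  obtain ⟨S, hS⟩ := exists_isometry_apply_eq (x := v) (y := !₂[0, ‖v‖])
    (by simp [EuclideanSpace.norm_eq])
  refine ⟨S.trans T.symm, ?_⟩
  rw [LinearIsometryEquiv.trans_apply, ← T.inner_map_map, T.apply_symm_apply, hT, hS,
    Plane.inner_eq]
  simp

end OrthogonalPosition

section QuadrantFolding

open Metric Set

theorem measure_setOf_inner_eq_zero {V : Type*} [NormedAddCommGroup V] [InnerProductSpace ℝ V]
    [FiniteDimensional ℝ V] [MeasurableSpace V] [BorelSpace V] (μ : Measure V)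
    [μ.IsAddHaarMeasure] {a : V} (ha : a ≠ 0) : μ {x | inner ℝ a x = 0} = 0 := by
  have hset : {x | inner ℝ a x = 0} = (ℝ ∙ a)ᗮ := by
    ext x; exact Submodule.mem_orthogonal_singleton_iff_inner_right.symm
  rw [hset]
  exact Measure.addHaar_submodule μ _ fun htop =>
    ha (Submodule.span_singleton_eq_bot.1 ((Submodule.orthogonal_eq_top_iff _).1 htop))

/-- The reflection of the plane with matrix `[c, s; s, -c]`, in a line through the origin. It gives
the symmetries of the rhombus and the coordinates in its Voronoi cells. -/
noncomputable def Plane.reflection (c s : ℝ) (h : c ^ 2 + s ^ 2 = 1) : Plane ≃ₗᵢ[ℝ] Plane :=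
  LinearIsometry.toLinearIsometryEquiv
    { toFun := fun x => !₂[c * x 0 + s * x 1, s * x 0 - c * x 1]
      map_add' := fun x y => by
        ext i
        fin_cases i <;>
          simp only [PiLp.add_apply, Matrix.cons_val_zero, Matrix.cons_val_one, Fin.zero_eta,
            Fin.mk_one] <;> ring
      map_smul' := fun r x => by
        ext i
        fin_cases i <;>
          simp only [PiLp.smul_apply, smul_eq_mul, RingHom.id_apply, Matrix.cons_val_zero,
            Matrix.cons_val_one, Fin.zero_eta, Fin.mk_one] <;> ring
      norm_map' := fun x => by
        rw [← sq_eq_sq₀ (norm_nonneg _) (norm_nonneg _), Plane.norm_sq, Plane.norm_sq]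
        simp only [LinearMap.coe_mk, AddHom.coe_mk, Matrix.cons_val_zero, Matrix.cons_val_one]
        linear_combination (x 0 ^ 2 + x 1 ^ 2) * h } rfl

theorem Plane.reflection_apply {c s : ℝ} (h : c ^ 2 + s ^ 2 = 1) (x : Plane) :
    Plane.reflection c s h x = !₂[c * x 0 + s * x 1, s * x 0 - c * x 1] :=
  rfl

/-- The open first quadrant of the plane. -/
def quadrant : Set Plane := {x | 0 < x 0 ∧ 0 < x 1}

theorem measurableSet_quadrant : MeasurableSet quadrant := by
  simp only [quadrant, ofPred_and]
  exact (measurableSet_lt (by fun_prop) (by fun_prop)).inter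
    (measurableSet_lt (by fun_prop) (by fun_prop))

theorem Plane.lintegral_eq_two_mul_setLIntegral_pos {T : Plane ≃ₗᵢ[ℝ] Plane} {i : Fin 2}
    (hT : ∀ x, T x i = -x i) {g : Plane → ℝ≥0∞} (hg : ∀ x, g (T x) = g x) :
    ∫⁻ x, g x = 2 * ∫⁻ x in {x | 0 < x i}, g x := by
  refine lintegral_eq_two_mul_setLIntegral T.measurePreserving
    T.toHomeomorph.measurableEmbedding (measurableSet_lt (by fun_prop) (by fun_prop)) ?_ hg
  have hne : ∀ᵐ x : Plane, x i ≠ 0 := by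
    have hnull := measure_setOf_inner_eq_zero (volume : Measure Plane)
      (a := EuclideanSpace.single i 1) (by simp)
    simpa only [ae_iff, not_not, EuclideanSpace.inner_single_left, map_one, one_mul] using hnull
  filter_upwards [hne] with x hx
  change (0 < T x i) = ¬ 0 < x i
  rw [hT, neg_pos, not_lt, eq_iff_iff, le_iff_lt_or_eq, or_iff_left hx]

theorem lintegral_eq_four_mul_setLIntegral_quadrant {g : Plane → ℝ≥0∞}
    (h₀ : ∀ x, g !₂[-x 0, x 1] = g x) (h₁ : ∀ x, g !₂[x 0, -x 1] = g x) :
    ∫⁻ x, g x = 4 * ∫⁻ x in quadrant, g x := by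
  have hpos : MeasurableSet {x : Plane | 0 < x 0} := measurableSet_lt (by fun_prop) (by fun_prop)
  calc ∫⁻ x, g x = 2 * ∫⁻ x in {x | 0 < x 0}, g x :=
        Plane.lintegral_eq_two_mul_setLIntegral_pos (T := Plane.reflection (-1) 0 (by norm_num))
          (fun x => by simp [Plane.reflection_apply])
          (fun x => by simp [Plane.reflection_apply, h₀])
    _ = 2 * ∫⁻ x, {x | 0 < x 0}.indicator g x := by rw [lintegral_indicator hpos]
    _ = 2 * (2 * ∫⁻ x in {x | 0 < x 1}, {x | 0 < x 0}.indicator g x) := by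
        rw [Plane.lintegral_eq_two_mul_setLIntegral_pos
          (T := Plane.reflection 1 0 (by norm_num)) (i := 1)
          (fun x => by simp [Plane.reflection_apply])
          (fun x => by simp [Plane.reflection_apply, indicator, h₁])]
    _ = 4 * ∫⁻ x in quadrant, g x := by
        rw [setLIntegral_indicator hpos, ← mul_assoc]
        norm_num [quadrant, ofPred_and]

theorem infDist_antipodal_map_of_eq_or_eq_neg {n : ℕ}
    {T : EuclideanSpace ℝ (Fin n) ≃ₗᵢ[ℝ] EuclideanSpace ℝ (Fin n)}
    {u v : EuclideanSpace ℝ (Fin n)} (hu : T u = u ∨ T u = -u) (hv : T v = v ∨ T v = -v)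
    (x : EuclideanSpace ℝ (Fin n)) :
    infDist (T x) (range (antipodal (u, v))) = infDist x (range (antipodal (u, v))) := by
  rw [← infDist_antipodal_map T u v x]
  congr 1
  simp only [range_antipodal]
  rcases hu with hu | hu <;> rcases hv with hv | hv <;> rw [hu, hv] <;> grind

theorem infDist_antipodal_of_inner_nonneg {n : ℕ} {u v x : EuclideanSpace ℝ (Fin n)}
    (hu : 0 ≤ inner ℝ x u) (hv : 0 ≤ inner ℝ x v) :
    infDist x (range (antipodal (u, v))) = min (dist x u) (dist x v) := by
  have hneg : ∀ {w : EuclideanSpace ℝ (Fin n)}, 0 ≤ inner ℝ x w → dist x w ≤ dist x (-w) := by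
    intro w hw
    rw [dist_eq_norm, dist_eq_norm, ← sq_le_sq₀ (norm_nonneg _) (norm_nonneg _), sub_neg_eq_add,
      norm_sub_sq_real, norm_add_sq_real]
    linarith
  rw [range_antipodal]
  refine le_antisymm (le_min (infDist_le_dist_of_mem (by simp)) (infDist_le_dist_of_mem (by simp)))
    ((le_infDist (insert_nonempty _ _)).2 ?_)
  rintro y (rfl | rfl | rfl | rfl)
  · exact min_le_left _ _
  · exact min_le_of_left_le (hneg hu)
  · exact min_le_right _ _
  · exact min_le_of_right_le (hneg hv)

end QuadrantFolding

section Rhombus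

open Metric Set

theorem setLIntegral_comp_dist {V : Type*} [NormedAddCommGroup V] [InnerProductSpace ℝ V]
    [FiniteDimensional ℝ V] [MeasurableSpace V] [BorelSpace V] (T : V ≃ₗᵢ[ℝ] V) (p : V)
    (A : Set V) (F : ℝ → ℝ≥0∞) :
    ∫⁻ x in A, F (dist x p) = ∫⁻ z in (fun z => p + T z) ⁻¹' A, F ‖z‖ := by
  rw [← ((measurePreserving_add_left volume p).comp
    T.measurePreserving).setLIntegral_comp_preimage_emb
    ((measurableEmbedding_addLeft p).comp T.toHomeomorph.measurableEmbedding)]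
  simp only [Function.comp_apply, dist_self_add_left, T.norm_map]
  rfl

theorem norm_lt_dist_iff {V : Type*} [NormedAddCommGroup V] [InnerProductSpace ℝ V] {z w : V} :
    ‖z‖ < dist z w ↔ 2 * inner ℝ z w < ‖w‖ ^ 2 := by
  rw [dist_eq_norm, ← sq_lt_sq₀ (norm_nonneg _) (norm_nonneg _), norm_sub_sq_real]
  constructor <;> intro h <;> linarith

theorem norm_le_dist_iff {V : Type*} [NormedAddCommGroup V] [InnerProductSpace ℝ V] {z w : V} :
    ‖z‖ ≤ dist z w ↔ 2 * inner ℝ z w ≤ ‖w‖ ^ 2 := by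
  rw [dist_eq_norm, ← sq_le_sq₀ (norm_nonneg _) (norm_nonneg _), norm_sub_sq_real]
  constructor <;> intro h <;> linarith

/-- The points of the quadrant nearer to `(Lc, 0)` than to `(0, Ls)`, in coordinates centered at
`(Lc, 0)` whose first axis points to `(0, Ls)`; here `c ^ 2 + s ^ 2 = 1`. -/
def firstCell (c s L : ℝ) : Set Plane :=
  {z | 0 < s * z 0 + c * z 1 ∧ 0 < L * c - c * z 0 + s * z 1 ∧ 2 * z 0 < L}

/-- The remaining points of the quadrant, in coordinates centered at `(0, Ls)` whose second axis
points away from `(Lc, 0)`. -/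
def secondCell (c s L : ℝ) : Set Plane :=
  {z | s * z 0 + c * z 1 < 0 ∧ 0 < L * s - c * z 0 + s * z 1 ∧ -L ≤ 2 * z 1}

/-- The quadrant-shaped region that `firstCell c s L` and `secondCell c s L` fill up, apart from a
null set, when `c = s`. -/
def squareCell (L : ℝ) : Set Plane := {z | 2 * z 0 < L ∧ -L ≤ 2 * z 1}

variable {c s L : ℝ}

theorem preimage_eq_firstCell (h : (-c) ^ 2 + s ^ 2 = 1) (hL : 0 < L) :
    (fun z => !₂[L * c, 0] + Plane.reflection (-c) s h z) ⁻¹'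
      (quadrant ∩ {x | dist x !₂[L * c, 0] < dist x !₂[0, L * s]}) = firstCell c s L := by
  have hq : (!₂[0, L * s] : Plane) = !₂[L * c, 0] + Plane.reflection (-c) s h !₂[L, 0] := by
    ext i; fin_cases i <;> simp [Plane.reflection_apply, mul_comm]
  have hdist (z : Plane) : ‖z‖ < dist z !₂[L, 0] ↔ 2 * z 0 < L := by
    rw [norm_lt_dist_iff, Plane.inner_eq, Plane.norm_sq]
    simp [pow_two, ← mul_assoc, hL]
  ext z
  rw [hq, mem_preimage, mem_inter_iff, mem_ofPred_eq, dist_add_left, LinearIsometryEquiv.dist_map,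
    dist_self_add_left, LinearIsometryEquiv.norm_map, hdist]
  simp only [quadrant, firstCell, mem_ofPred_eq, Plane.reflection_apply, PiLp.add_apply,
    Matrix.cons_val_zero, Matrix.cons_val_one]
  ring_nf
  tauto

theorem preimage_eq_secondCell (h : (-s) ^ 2 + (-c) ^ 2 = 1) (hL : 0 < L) :
    (fun z => !₂[0, L * s] + Plane.reflection (-s) (-c) h z) ⁻¹'
      (quadrant \ {x | dist x !₂[L * c, 0] < dist x !₂[0, L * s]}) = secondCell c s L := by
  have hp : (!₂[L * c, 0] : Plane) = !₂[0, L * s] + Plane.reflection (-s) (-c) h !₂[0, -L] := by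
    ext i; fin_cases i <;> simp [Plane.reflection_apply, mul_comm]
  have hdist (z : Plane) : ‖z‖ ≤ dist z !₂[0, -L] ↔ -L ≤ 2 * z 1 := by
    rw [norm_le_dist_iff, Plane.inner_eq, Plane.norm_sq,
      ← mul_le_mul_iff_right₀ hL (b := -L)]
    simp only [Matrix.cons_val_zero, Matrix.cons_val_one]
    constructor <;> intro h <;> linarith
  ext z
  rw [hp, mem_preimage, mem_sdiff, mem_ofPred_eq, dist_add_left, LinearIsometryEquiv.dist_map,
    dist_self_add_left, LinearIsometryEquiv.norm_map, not_lt, hdist]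
  simp only [quadrant, secondCell, mem_ofPred_eq, Plane.reflection_apply, PiLp.add_apply,
    Matrix.cons_val_zero, Matrix.cons_val_one]
  rw [and_assoc]
  refine and_congr ?_ (and_congr ?_ Iff.rfl) <;> constructor <;> intro h <;> linarith

theorem disjoint_firstCell_secondCell : Disjoint (firstCell c s L) (secondCell c s L) :=
  disjoint_left.2 fun _ h h' => h.1.not_gt h'.1

theorem measurableSet_secondCell : MeasurableSet (secondCell c s L) := by
  simp only [secondCell, ofPred_and]
  exact (measurableSet_lt (by fun_prop) (by fun_prop)).inter
    ((measurableSet_lt (by fun_prop) (by fun_prop)).inter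
      (measurableSet_le (by fun_prop) (by fun_prop)))

theorem setLIntegral_quadrant_infDist_antipodal (hc : 0 ≤ c) (hs : 0 ≤ s)
    (h : c ^ 2 + s ^ 2 = 1) (hL : 0 < L) (F : ℝ → ℝ≥0∞) :
    ∫⁻ x in quadrant, F (infDist x (range (antipodal (!₂[L * c, 0], !₂[0, L * s])))) =
      ∫⁻ z in firstCell c s L ∪ secondCell c s L, F ‖z‖ := by
  let p : Plane := !₂[L * c, 0]
  let q : Plane := !₂[0, L * s]
  have hnear : MeasurableSet {x | dist x p < dist x q} :=
    measurableSet_lt (by fun_prop) (by fun_prop)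
  have hmin : ∀ x ∈ quadrant, infDist x (range (antipodal (p, q))) = min (dist x p) (dist x q) := by
    intro x hx
    have hx₀ := hx.1.le
    have hx₁ := hx.2.le
    apply infDist_antipodal_of_inner_nonneg <;> rw [Plane.inner_eq] <;>
      simp only [p, q, Matrix.cons_val_zero, Matrix.cons_val_one, mul_zero, add_zero, zero_add] <;>
      positivity
  rw [← lintegral_inter_add_sdiff _ quadrant hnear, lintegral_union measurableSet_secondCell
    disjoint_firstCell_secondCell]
  congr 1
  · calc ∫⁻ x in quadrant ∩ {x | dist x p < dist x q}, F (infDist x (range (antipodal (p, q))))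
        = ∫⁻ x in quadrant ∩ {x | dist x p < dist x q}, F (dist x p) :=
          setLIntegral_congr_fun (measurableSet_quadrant.inter hnear) fun x hx => by
            simp only [hmin x hx.1, min_eq_left (show dist x p < dist x q from hx.2).le]
      _ = ∫⁻ z in firstCell c s L, F ‖z‖ := by
          rw [setLIntegral_comp_dist (Plane.reflection (-c) s (by rwa [neg_sq])),
            preimage_eq_firstCell _ hL]
  · calc ∫⁻ x in quadrant \ {x | dist x p < dist x q}, F (infDist x (range (antipodal (p, q))))
        = ∫⁻ x in quadrant \ {x | dist x p < dist x q}, F (dist x q) :=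
          setLIntegral_congr_fun (measurableSet_quadrant.diff hnear) fun x hx => by
            simp only [hmin x hx.1, min_eq_right (le_of_not_gt hx.2 : dist x q ≤ dist x p)]
      _ = ∫⁻ z in secondCell c s L, F ‖z‖ := by
          rw [setLIntegral_comp_dist
            (Plane.reflection (-s) (-c) (by rw [neg_sq, neg_sq, add_comm, h])),
            preimage_eq_secondCell _ hL]

theorem lintegral_infDist_antipodal_axes (hc : 0 ≤ c) (hs : 0 ≤ s) (h : c ^ 2 + s ^ 2 = 1)
    (hL : 0 < L) (F : ℝ → ℝ≥0∞) :
    ∫⁻ x, F (infDist x (range (antipodal (!₂[L * c, 0], !₂[0, L * s])))) =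
      4 * ∫⁻ z in firstCell c s L ∪ secondCell c s L, F ‖z‖ := by
  rw [← setLIntegral_quadrant_infDist_antipodal hc hs h hL]
  refine lintegral_eq_four_mul_setLIntegral_quadrant (fun x => ?_) fun x => ?_
  · have hx : (!₂[-x 0, x 1] : Plane) = Plane.reflection (-1) 0 (by norm_num) x := by
      simp [Plane.reflection_apply]
    rw [hx, infDist_antipodal_map_of_eq_or_eq_neg (.inr _) (.inl _)] <;>
      (ext i; fin_cases i <;> simp [Plane.reflection_apply])
  · have hx : (!₂[x 0, -x 1] : Plane) = Plane.reflection 1 0 (by norm_num) x := by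
      simp [Plane.reflection_apply]
    rw [hx, infDist_antipodal_map_of_eq_or_eq_neg (.inl _) (.inr _)] <;>
      (ext i; fin_cases i <;> simp [Plane.reflection_apply])

theorem firstCell_union_secondCell_subset_squareCell (hc : 0 ≤ c) (hs : 0 ≤ s)
    (h : c ^ 2 + s ^ 2 = 1) (hL : 0 < L) :
    firstCell c s L ∪ secondCell c s L ⊆ squareCell L := by
  have hcs : 2 * (L * (c * s)) ≤ L := by nlinarith [sq_nonneg (c - s)]
  rintro z (⟨hz₀, hz₁, hz⟩ | ⟨hz₀, hz₁, hz⟩)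
  · have hcomb : s * (L * c - c * z 0 + s * z 1) + c * (s * z 0 + c * z 1) = L * (c * s) + z 1 := by
      linear_combination z 1 * h
    have hnonneg : 0 ≤ L * (c * s) + z 1 := by rw [← hcomb]; positivity
    exact ⟨hz, by linarith⟩
  · have hcomb : c * (L * s - c * z 0 + s * z 1) + s * -(s * z 0 + c * z 1) =
        L * (c * s) - z 0 := by
      linear_combination -z 0 * h
    have hcs₀ : 0 < c ∨ 0 < s := by by_contra! hneg; nlinarith
    have hz₀' : 0 < -(s * z 0 + c * z 1) := neg_pos.2 hz₀
    have hpos : 0 < L * (c * s) - z 0 := by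
      rw [← hcomb]; rcases hcs₀ with hc₀ | hs₀ <;> positivity
    exact ⟨by linarith, hz⟩

theorem squareCell_ae_le_firstCell_union_secondCell (hc : 0 < c) :
    squareCell L ≤ᵐ[volume] (firstCell c c L ∪ secondCell c c L : Set Plane) := by
  have hne : ∀ᵐ z : Plane, z 0 + z 1 ≠ 0 := by
    have hnull := measure_setOf_inner_eq_zero (volume : Measure Plane) (a := !₂[1, 1]) (by simp)
    simpa [ae_iff, Plane.inner_eq] using hnull
  filter_upwards [hne] with z hz hzL
  have hfactor : L * c - c * z 0 + c * z 1 = c * (L - z 0 + z 1) := by ring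
  rcases hz.lt_or_gt with hneg | hpos
  · refine .inr ⟨?_, ?_, hzL.2⟩
    · rw [← mul_add]; exact mul_neg_of_pos_of_neg hc hneg
    · rw [hfactor]; exact mul_pos hc (by linarith [hzL.2])
  · refine .inl ⟨?_, ?_, hzL.1⟩
    · rw [← mul_add]; exact mul_pos hc hpos
    · rw [hfactor]; exact mul_pos hc (by linarith [hzL.1])

end Rhombus

section Optimality

open Metric Set

theorem Plane.exists_isometry_apply_eq_axes {u v : Plane} (h : inner ℝ u v = 0) :
    ∃ T : Plane ≃ₗᵢ[ℝ] Plane, T u = !₂[‖u‖, 0] ∧ T v = !₂[0, ‖v‖] := by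
  have hpair : Pairwise fun i j => inner ℝ (![u, v] i) (![u, v] j) = 0 := by
    intro i j hij
    fin_cases i <;> fin_cases j <;> simp_all [real_inner_comm]
  obtain ⟨b, hb⟩ : ∃ b : OrthonormalBasis (Fin 2) ℝ Plane, ∀ i, ![u, v] i = ‖![u, v] i‖ • b i := by
    refine ⟨InnerProductSpace.gramSchmidtOrthonormalBasis finrank_euclideanSpace ![u, v],
      fun i => ?_⟩
    by_cases hi : ![u, v] i = 0
    · simp [hi]
    · rw [InnerProductSpace.gramSchmidtOrthonormalBasis_apply_of_orthogonal _ hpair hi]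
      simp [smul_smul, hi]
  refine ⟨b.repr, ?_, ?_⟩
  · calc b.repr u = b.repr (‖u‖ • b 0) := congrArg b.repr (hb 0)
      _ = !₂[‖u‖, 0] := by
        rw [map_smul, b.repr_self]; ext i; fin_cases i <;> simp
  · calc b.repr v = b.repr (‖v‖ • b 1) := congrArg b.repr (hb 1)
      _ = !₂[0, ‖v‖] := by
        rw [map_smul, b.repr_self]; ext i; fin_cases i <;> simp

theorem lintegral_infDist_antipodal_eq_axes_of_orthogonal {u v : Plane} (h : inner ℝ u v = 0)
    (F : ℝ → ℝ≥0∞) :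
    ∫⁻ x, F (infDist x (range (antipodal (u, v)))) =
      ∫⁻ x, F (infDist x (range (antipodal (!₂[‖u‖, 0], !₂[0, ‖v‖])))) := by
  obtain ⟨T, hu, hv⟩ := Plane.exists_isometry_apply_eq_axes h
  rw [← lintegral_infDist_antipodal_map T, hu, hv]

theorem lintegral_infDist_antipodal_axes_le_square {c s L : ℝ} (hc : 0 ≤ c) (hs : 0 ≤ s)
    (h : c ^ 2 + s ^ 2 = 1) (hL : 0 < L) {a : ℝ} (ha : 0 ≤ a) (haL : a ^ 2 + a ^ 2 = 1)
    (F : ℝ → ℝ≥0∞) :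
    ∫⁻ x, F (infDist x (range (antipodal (!₂[L * c, 0], !₂[0, L * s])))) ≤
      ∫⁻ x, F (infDist x (range (antipodal (!₂[L * a, 0], !₂[0, L * a])))) := by
  rw [lintegral_infDist_antipodal_axes hc hs h hL, lintegral_infDist_antipodal_axes ha ha haL hL]
  have ha₀ : 0 < a := ha.lt_of_ne (by rintro rfl; norm_num at haL)
  gcongr 4 * ?_
  exact lintegral_mono_set'
    ((firstCell_union_secondCell_subset_squareCell hc hs h hL).eventuallyLE.trans
      (squareCell_ae_le_firstCell_union_secondCell ha₀))

theorem lintegral_infDist_antipodal_le_of_orthogonal {u v u' v' : Plane} (h : inner ℝ u v = 0)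
    (h' : inner ℝ u' v' = 0) (hlen : ‖u'‖ = ‖v'‖) (hsum : ‖u‖ ^ 2 + ‖v‖ ^ 2 = ‖u'‖ ^ 2 + ‖v'‖ ^ 2)
    (F : ℝ → ℝ≥0∞) :
    ∫⁻ x, F (infDist x (range (antipodal (u, v)))) ≤
      ∫⁻ x, F (infDist x (range (antipodal (u', v')))) := by
  rw [lintegral_infDist_antipodal_eq_axes_of_orthogonal h,
    lintegral_infDist_antipodal_eq_axes_of_orthogonal h', ← hlen]
  rw [← hlen] at hsum
  rcases (norm_nonneg u').eq_or_lt with hzero | hpos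
  · rw [← hzero] at hsum ⊢
    have hu : ‖u‖ = 0 := by nlinarith [sq_nonneg ‖u‖, sq_nonneg ‖v‖]
    have hv : ‖v‖ = 0 := by nlinarith [sq_nonneg ‖u‖, sq_nonneg ‖v‖]
    rw [hu, hv]
  · let L := √(‖u'‖ ^ 2 + ‖u'‖ ^ 2)
    have hL : 0 < L := Real.sqrt_pos.2 (by positivity)
    have hsq : L ^ 2 = ‖u'‖ ^ 2 + ‖u'‖ ^ 2 := Real.sq_sqrt (by positivity)
    have hle := lintegral_infDist_antipodal_axes_le_square (c := ‖u‖ / L) (s := ‖v‖ / L)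
      (a := ‖u'‖ / L) (by positivity) (by positivity)
      (by rw [div_pow, div_pow, ← add_div, hsum, hsq, div_self (by positivity)]) hL (by positivity)
      (by rw [div_pow, ← add_div, hsq, div_self (by positivity)]) F
    simpa only [mul_div_cancel₀ _ hL.ne'] using hle

theorem lintegral_infDist_antipodal_le_of_antitone {F : ℝ → ℝ≥0∞} (hF : Antitone F)
    (u v : Plane) {u' v' : Plane} (h' : inner ℝ u' v' = 0) (hlen : ‖u'‖ = ‖v'‖)
    (hsum : ‖u‖ ^ 2 + ‖v‖ ^ 2 = ‖u'‖ ^ 2 + ‖v'‖ ^ 2) :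
    ∫⁻ x, F (infDist x (range (antipodal (u, v)))) ≤
      ∫⁻ x, F (infDist x (range (antipodal (u', v')))) := by
  obtain ⟨T, hT⟩ := Plane.exists_isometry_inner_eq_zero u v
  exact (lintegral_infDist_antipodal_le_map hF T hT).trans
    (lintegral_infDist_antipodal_le_of_orthogonal hT h' hlen (by rwa [T.norm_map]) F)

end Optimality

theorem mainTheorem2 (E : ℝ) (v₁ v₂ : EuclideanSpace ℝ (Fin 2))
    (horth : inner ℝ v₁ v₂ = 0) (hlen : ‖v₁‖ = ‖v₂‖) (hE : ‖v₁‖ ^ 2 + ‖v₂‖ ^ 2 = E) :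
    -- the Gaussian density
    IsMaxOn (fun w => gaussianP (antipodal w))
      {w : EuclideanSpace ℝ (Fin 2) × EuclideanSpace ℝ (Fin 2) | ‖w.1‖ ^ 2 + ‖w.2‖ ^ 2 = E}
      (v₁, v₂) ∧
    -- every radially symmetric nonincreasing density
    (∀ f : EuclideanSpace ℝ (Fin 2) → ℝ≥0∞, Measurable f → IsRadiallyNonincreasing f →
      IsMaxOn (fun w => densityP f (antipodal w))
        {w : EuclideanSpace ℝ (Fin 2) × EuclideanSpace ℝ (Fin 2) | ‖w.1‖ ^ 2 + ‖w.2‖ ^ 2 = E}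
        (v₁, v₂) ∧
      IsMaxOn (fun w => voronoiP f (antipodal w))
        {w : EuclideanSpace ℝ (Fin 2) × EuclideanSpace ℝ (Fin 2) | ‖w.1‖ ^ 2 + ‖w.2‖ ^ 2 = E}
        (v₁, v₂)) ∧
    -- every radially symmetric density, among the orthogonal pairs
    (∀ f : EuclideanSpace ℝ (Fin 2) → ℝ≥0∞, Measurable f → IsRadial f →
      IsMaxOn (fun w => voronoiP f (antipodal w))
        {w : EuclideanSpace ℝ (Fin 2) × EuclideanSpace ℝ (Fin 2) |
          inner ℝ w.1 w.2 = 0 ∧ ‖w.1‖ ^ 2 + ‖w.2‖ ^ 2 = E}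
        (v₁, v₂)) := by
  have hdensity : ∀ f : Plane → ℝ≥0∞, IsRadiallyNonincreasing f →
      ∀ w : Plane × Plane, ‖w.1‖ ^ 2 + ‖w.2‖ ^ 2 = E →
        densityP f (antipodal w) ≤ densityP f (antipodal (v₁, v₂)) := by
    intro f hf w hw
    obtain ⟨F, hF, rfl⟩ := hf.exists_antitone_eq_comp_norm
    rw [densityP_comp_norm hF, densityP_comp_norm hF]
    exact lintegral_infDist_antipodal_le_of_antitone hF w.1 w.2 horth hlen (hw.trans hE.symm)
  refine ⟨fun w hw => gaussianP_le_gaussianP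
    (hdensity _ isRadiallyNonincreasing_rexp_neg_sq_norm w hw),
    fun f _ hf => ⟨hdensity f hf, fun w hw => ?_⟩, fun f _ hf w hw => ?_⟩
  · obtain ⟨F, hF, rfl⟩ := hf.exists_antitone_eq_comp_norm
    change voronoiP _ _ ≤ voronoiP _ _
    rw [voronoiP_comp_norm, voronoiP_comp_norm]
    exact lintegral_infDist_antipodal_le_of_antitone hF w.1 w.2 horth hlen (hw.trans hE.symm)
  · obtain ⟨F, rfl⟩ := hf.exists_eq_comp_norm
    change voronoiP _ _ ≤ voronoiP _ _
    rw [voronoiP_comp_norm, voronoiP_comp_norm]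
    exact lintegral_infDist_antipodal_le_of_orthogonal hw.1 horth hlen (hw.2.trans hE.symm) F
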